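/- Let $n\ge 1$ and consider $n$ qubits. A Pauli operator is a tensor product $P=\bigotimes_{j=1}^n P_j$ with $P_j\in\{I,\sigma_x,\sigma_y,\sigma_z\}$; its Pauli weight is the number of $j$ with $P_j\neq I$. For a jump operator $L$ put $\mathcal D_L(\rho)=L\rho L^\dagger-\tfrac12(L^\dagger L\rho+\rho L^\dagger L)$. Consider a signal operator $S$, a Pauli operator different from the identity, and noise operators $P_1,\dots,P_N$ ($N\ge 0$), which are Pauli operators, with decay rates $\gamma_1,\dots,\gamma_N>0$, and the Lindblad master equation $$\dot\rho = G_\theta(\rho),\qquad G_\theta=\theta^2\,\mathcal D_S+\sum_{k=1}^N\gamma_k\,\mathcal D_{P_k},$$ where $\theta\geq 0$, the square root of the signal decay rate, is the parameter to be estimated. The quantum Fisher information (QFI) $\mathcal I_Q(\rho_\theta)$ about $\theta$ of a differentiable family of states $\rho_\theta$ is the supremum, over all POVMs with finitely many outcomes, of the classical Fisher information $\sum_j(\partial_\theta p_j)^2/p_j$ of the outcome probabilities $p_j(\theta)$ (terms with $p_j=0$ are omitted). Let $T>0$ be the total time. Noiseless QFI. Take $N=0$. For $\theta>0$ let $F_T(\theta)$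 be the supremum of the QFI about $\theta$ of the final state over all extended sequential strategies with fast and precise control: an arbitrary initial state of the $n$ qubits and a noiseless ancilla of arbitrary finite dimension, any number $M\ge1$ of periods of free evolution of length $T/M$, and an arbitrary quantum channel on qubits and ancilla, independent of $\theta$, after each period. The noiseless QFI is $\lim_{\theta\to0^+}F_T(\theta)$. Unextended measure-and-reset QFI of a pure state $|\psi\rangle$ of the $n$ qubits. If $|\psi\rangle$ is prepared, evolved for the time $T/M$ and measured, $M$ times in total, the total QFI is $M\,\mathcal I_Q\big(e^{(T/M)G_\theta}(|\psi\rangle\langle\psi|)\big)$. The measure-and-reset QFI is the limit of this quantity when first $M\to\infty$ at fixed $\theta>0$, and then $\theta\to0^+$. Claim. For every $T>0$ the noiseless QFI for $S$ exists and equals $4T$. Moreover, there are single-qubit unitaries $U_1,\dots,U_n$, depending only on $S$, such that the unextended product state $|\psi\rangle=\bigotimes_{j=1}^n U_j|{\uparrow}\rangle$, where $\sigma_z|{\uparrow}\rangle=|{\uparrow}\rangle$, recovers the noiseless QFI whenever the Pauli weight of $S$ is strictly greater than that of every noise operator: for all $N\ge0$, all Pauli operators $P_1,\dots,P_N$ of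 Pauli weight strictly less than that of $S$, all $\gamma_1,\dots,\gamma_N>0$ and all $T>0$, the measure-and-reset QFI of $|\psi\rangle$ exists and equals $4T$. One can take $U_j=I$ for every $j$ with $S_j=\sigma_x$; in particular, if $S=\sigma_x^{\otimes n}$, then $|{\uparrow}\rangle^{\otimes n}$ itself recovers the noiseless QFI. -/

import Mathlib

open Filter Topology
open scoped ENNReal Matrix Kronecker ComplexOrder

noncomputable section

namespace LindbladEstimation

/-! ### Qubits and Pauli operators -/

/-- The labels of the four single-qubit Pauli operators, including the identity. -/
inductive Pauli where
  | I
  | X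
  | Y
  | Z
  deriving DecidableEq

/-- The `2 × 2` matrix of a Pauli operator; index `0` is the state `↑` and index `1` is `↓`. -/
def Pauli.mat : Pauli → Matrix (Fin 2) (Fin 2) ℂ
  | .I => !![1, 0; 0, 1]
  | .X => !![0, 1; 1, 0]
  | .Y => !![0, -Complex.I; Complex.I, 0]
  | .Z => !![1, 0; 0, -1]

/-- The labels of the computational basis of `n` qubits. -/
abbrev Qubits (n : ℕ) : Type := Fin n → Fin 2

/-- An `n`-qubit Pauli operator, given by its tensor factors. -/
abbrev PauliString (n : ℕ) : Type := Fin n → Pauli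

/-- The operator on `n` qubits that is the tensor product of the given Pauli factors. -/
def PauliString.op {n : ℕ} (s : PauliString n) : Matrix (Qubits n) (Qubits n) ℂ :=
  Matrix.of fun x y => ∏ j, (s j).mat (x j) (y j)

/-- The Pauli weight: the number of tensor factors that are not the identity. -/
def PauliString.weight {n : ℕ} (s : PauliString n) : ℕ :=
  (Finset.univ.filter fun j => s j ≠ Pauli.I).card

/-- The single-qubit state `↑`. -/
def ketUp : Fin 2 → ℂ := ![1, 0]

/-- The product state `φ 0 ⊗ φ 1 ⊗ ⋯ ⊗ φ (n - 1)`. -/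
def productState {n : ℕ} (φ : Fin n → Fin 2 → ℂ) : Qubits n → ℂ :=
  fun x => ∏ j, φ j (x j)

/-- The rank-one operator `|ψ⟩⟨ψ|`. -/
def pureState {ι : Type} (ψ : ι → ℂ) : Matrix ι ι ℂ :=
  Matrix.vecMulVec ψ (star ψ)

/-! ### Fisher information -/

/-- A measurement (POVM) with `k` outcomes. -/
structure POVM (ι : Type) [Fintype ι] [DecidableEq ι] (k : ℕ) where
  effect : Fin k → Matrix ι ι ℂ
  posSemidef : ∀ j, (effect j).PosSemidef
  sum_eq_one : ∑ j, effect j = 1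

/-- The probability of outcome `j` when the state `ρ` is measured. -/
def POVM.prob {ι : Type} [Fintype ι] [DecidableEq ι] {k : ℕ} (E : POVM ι k)
    (ρ : Matrix ι ι ℂ) (j : Fin k) : ℝ :=
  (ρ * E.effect j).trace.re

/-- The classical Fisher information at `θ` of a family of distributions `p θ` on `k` outcomes.
Outcomes of probability zero contribute `_ / 0 = 0`, that is, they are excluded. -/
def cfi {k : ℕ} (p : ℝ → Fin k → ℝ) (θ : ℝ) : ℝ :=
  ∑ j, (deriv (fun θ' => p θ' j) θ) ^ 2 / p θ j

/-- The quantum Fisher information at `θ` of a family of states `ρ θ`: the classical Fisher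
information, maximised over all measurements. -/
def qfi {ι : Type} [Fintype ι] [DecidableEq ι] (ρ : ℝ → Matrix ι ι ℂ) (θ : ℝ) : ℝ≥0∞ :=
  ⨆ (k : ℕ) (E : POVM ι k), ENNReal.ofReal (cfi (fun θ' => E.prob (ρ θ')) θ)

/-! ### The Lindblad master equation -/

/-- The Lindbladian superoperator `ρ ↦ L ρ L† - (L† L ρ + ρ L† L) / 2` of a jump operator `L`. -/
def dissipator {ι : Type} [Fintype ι] [DecidableEq ι] (L : Matrix ι ι ℂ) :
    Matrix ι ι ℂ →ₗ[ℂ] Matrix ι ι ℂ :=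
  LinearMap.mulLeft ℂ L ∘ₗ LinearMap.mulRight ℂ Lᴴ
    - (1 / 2 : ℂ) • (LinearMap.mulLeft ℂ (Lᴴ * L) + LinearMap.mulRight ℂ (Lᴴ * L))

/-- The generator of the master equation with signal jump operator `S` at decay rate `θ ^ 2`
(so that `θ` is the square root of the signal decay rate) and noise jump operators `L k` at
decay rates `γ k`, without Hamiltonian. -/
def generator {ι : Type} [Fintype ι] [DecidableEq ι] {N : ℕ} (S : Matrix ι ι ℂ)
    (L : Fin N → Matrix ι ι ℂ) (γ : Fin N → ℝ) (θ : ℝ) :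
    Matrix ι ι ℂ →ₗ[ℂ] Matrix ι ι ℂ :=
  ((θ ^ 2 : ℝ) : ℂ) • dissipator S + ∑ k, (γ k : ℂ) • dissipator (L k)

/-- The solution at time `t` of `dρ/dt = G ρ` with initial value `ρ`, i.e. `exp (t G) ρ`, written
as the (always convergent) exponential series. -/
def flow {ι : Type} [Fintype ι] [DecidableEq ι] (G : Matrix ι ι ℂ →ₗ[ℂ] Matrix ι ι ℂ) (t : ℝ)
    (ρ : Matrix ι ι ℂ) : Matrix ι ι ℂ :=
  ∑' m : ℕ, ((t ^ m / (m.factorial : ℝ) : ℝ) : ℂ) • (G ^ m) ρ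

/-! ### Measure-and-reset -/

/-- The total quantum Fisher information about `θ` of the unextended measure-and-reset strategy in
total time `T` with `M` repetitions: `M` times, the pure state `ψ` is prepared, it evolves for the
time `T / M`, and it is measured. -/
def measureResetQFI {ι : Type} [Fintype ι] [DecidableEq ι] {N : ℕ} (S : Matrix ι ι ℂ)
    (L : Fin N → Matrix ι ι ℂ) (γ : Fin N → ℝ) (ψ : ι → ℂ) (T : ℝ) (M : ℕ) (θ : ℝ) : ℝ≥0∞ :=
  (M : ℝ≥0∞) * qfi (fun θ' => flow (generator S L γ θ') (T / M) (pureState ψ)) θ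

/-- `q` is the quantum Fisher information of the measure-and-reset strategy with state `ψ` in the
vanishing signal limit: first the measurements become infinitely fast (`M → ∞` with `T` fixed),
then the signal vanishes (`θ → 0⁺`). -/
def IsMeasureResetQFI {ι : Type} [Fintype ι] [DecidableEq ι] {N : ℕ} (S : Matrix ι ι ℂ)
    (L : Fin N → Matrix ι ι ℂ) (γ : Fin N → ℝ) (ψ : ι → ℂ) (T : ℝ) (q : ℝ≥0∞) : Prop :=
  ∃ J : ℝ → ℝ≥0∞,
    (∀ θ : ℝ, 0 < θ → Tendsto (fun M : ℕ => measureResetQFI S L γ ψ T M θ) atTop (𝓝 (J θ))) ∧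
    Tendsto J (𝓝[>] 0) (𝓝 q)

/-! ### Fast and precise control -/

/-- A quantum channel (completely positive trace-preserving map), given by Kraus operators. -/
structure Channel (ι : Type) [Fintype ι] [DecidableEq ι] where
  rank : ℕ
  kraus : Fin rank → Matrix ι ι ℂ
  sum_eq_one : ∑ j, (kraus j)ᴴ * kraus j = 1

/-- The action of a channel on an operator. -/
def Channel.apply {ι : Type} [Fintype ι] [DecidableEq ι] (C : Channel ι) (ρ : Matrix ι ι ℂ) :
    Matrix ι ι ℂ :=
  ∑ j, C.kraus j * ρ * (C.kraus j)ᴴ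

/-- An extended sequential strategy: an initial state of the system together with a noiseless
ancilla of dimension `a`, and the control operations on system and ancilla that are applied after
the successive periods of free evolution. -/
structure SequentialStrategy (ι : Type) [Fintype ι] [DecidableEq ι] (a : ℕ) where
  init : Matrix (ι × Fin a) (ι × Fin a) ℂ
  init_posSemidef : init.PosSemidef
  init_trace : init.trace = 1
  control : ℕ → Channel (ι × Fin a)

/-- The state of system and ancilla after `m` periods of free evolution of length `t`, each one
followed by its control operation. The jump operators act as the identity on the ancilla. -/
def SequentialStrategy.state {ι : Type} [Fintype ι] [DecidableEq ι] {a N : ℕ}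
    (C : SequentialStrategy ι a) (S : Matrix ι ι ℂ) (L : Fin N → Matrix ι ι ℂ) (γ : Fin N → ℝ)
    (t θ : ℝ) : ℕ → Matrix (ι × Fin a) (ι × Fin a) ℂ
  | 0 => C.init
  | m + 1 => (C.control m).apply
      (flow (generator (S ⊗ₖ (1 : Matrix (Fin a) (Fin a) ℂ))
        (fun k => L k ⊗ₖ (1 : Matrix (Fin a) (Fin a) ℂ)) γ θ) t
        (SequentialStrategy.state C S L γ t θ m))

/-- The optimal quantum Fisher information about `θ` in total time `T` with fast and precise
control: the supremum over all extended sequential strategies with any number `M ≥ 1` of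
control steps, separated by the time `T / M`. -/
def optimalQFI {ι : Type} [Fintype ι] [DecidableEq ι] {N : ℕ} (S : Matrix ι ι ℂ)
    (L : Fin N → Matrix ι ι ℂ) (γ : Fin N → ℝ) (T θ : ℝ) : ℝ≥0∞ :=
  ⨆ (M : ℕ) (_ : 1 ≤ M) (a : ℕ) (C : SequentialStrategy ι a),
    qfi (fun θ' => C.state S L γ (T / M) θ' M) θ

/-- `q` is the noiseless quantum Fisher information for the signal jump operator `S`: the vanishing
signal limit of the optimal quantum Fisher information when there is no noise jump operator. -/
def IsNoiselessQFI {ι : Type} [Fintype ι] [DecidableEq ι] (S : Matrix ι ι ℂ) (T : ℝ)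
    (q : ℝ≥0∞) : Prop :=
  Tendsto (fun θ : ℝ => optimalQFI S (![] : Fin 0 → Matrix ι ι ℂ) ![] T θ) (𝓝[>] 0) (𝓝 q)

end LindbladEstimation

end

open LindbladEstimation

/-! Pauli operators commute up to sign, so their dissipators commute and the flow factorises. The
noise produces a state `σ t` independent of `θ`, and the signal then applies `S` with probability `q
= (1 - exp (-2tθ²)) / 2`. All dependence on `θ` sits in this one Bernoulli weight.

Upper bound: after several periods the state is a mixture of `θ`-independent states, with product
weights. Fisher information of the weights adds over periods, is unaffected by control channels and
dominates the QFI (`HasMixtureInformation.qfi_le`). One flip carries at most `4t` (`flipInfo_le`),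
hence at most `4T` in total.

Lower bound: test for the state `Sψ`. If `Sψ` is orthogonal to `ψ` and to every `L k ψ`, noise
reaches `Sψ` with probability `o(t)`, while the signal reaches it with probability about `θ²t`. The
term `p'² / p` is then about `(2tθ)² / (θ²t) = 4t`.

The weight condition supplies the orthogonality: some qubit carries a nontrivial factor of `S` and a
trivial factor of the noise operator. There the probe is sent to an orthogonal state by `S` and left
alone by the noise, so one factor of the inner product vanishes. -/

namespace LindbladEstimation

/-! ### The exponential of a generator -/

section BanachAlgebra

variable {𝔸 : Type*} [NormedRing 𝔸] [NormedAlgebra ℂ 𝔸] [CompleteSpace 𝔸]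

/-- The exponential of a multiple of `D` when `-D / 2` is idempotent. -/
theorem exp_smul_of_mul_self {D : 𝔸} (hD : D * D = (-2 : ℂ) • D) (c : ℂ) :
    NormedSpace.exp (c • D) = 1 + ((1 - Complex.exp (-2 * c)) / 2) • D := by
  have hpow : ∀ n : ℕ, D ^ (n + 1) = ((-2 : ℂ) ^ n) • D := by
    intro n
    induction n with
    | zero => simp
    | succ k ih => rw [pow_succ, ih, smul_mul_assoc, hD, smul_smul, pow_succ]
  have h1 : HasSum (fun n : ℕ => ((n.factorial : ℂ)⁻¹ * (-2 * c) ^ n) • ((-1 / 2 : ℂ) • D))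
      (Complex.exp (-2 * c) • ((-1 / 2 : ℂ) • D)) := by
    have h := NormedSpace.exp_series_hasSum_exp' (𝕂 := ℂ) (-2 * c)
    rw [← Complex.exp_eq_exp_ℂ] at h
    simpa using h.smul_const ((-1 / 2 : ℂ) • D)
  -- For `n ≥ 1` the exponential series is that of the scalar times `-D / 2`. At `n = 0` the latter
  -- gives `-D / 2` instead of `1`, which this term corrects.
  have h2 : HasSum (fun n : ℕ => if n = 0 then (1 : 𝔸) + (1 / 2 : ℂ) • D else 0)
      (1 + (1 / 2 : ℂ) • D) := hasSum_ite_eq 0 _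
  have h3 := NormedSpace.exp_series_hasSum_exp' (𝕂 := ℂ) (c • D)
  refine h3.unique ?_
  convert h1.add h2 using 1
  · funext n
    rcases n with _ | n
    · simp only [Nat.factorial_zero, Nat.cast_one, inv_one, pow_zero, one_smul, mul_one, if_true]
      module
    · rw [smul_pow, hpow]
      simp only [Nat.succ_ne_zero, if_false, add_zero, smul_smul]
      congr 1
      rw [mul_pow, pow_succ (-2 : ℂ)]
      ring
  · module

end BanachAlgebra

/-! ### Flows on a finite-dimensional space, independent of the choice of norm -/

section LinearFlow

variable {V : Type*}

/-- The flow of a linear vector field, as an exponential series. -/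
noncomputable def linearFlow [AddCommGroup V] [Module ℂ V] [TopologicalSpace V] (G : V →ₗ[ℂ] V) (t : ℝ) (x : V) :
    V :=
  ∑' m : ℕ, ((t ^ m / (m.factorial : ℝ) : ℝ) : ℂ) • (G ^ m) x

variable [NormedAddCommGroup V] [NormedSpace ℂ V] [FiniteDimensional ℂ V]

theorem linearFlow_eq_exp (G : V →ₗ[ℂ] V) (t : ℝ) (x : V) :
    linearFlow G t x = NormedSpace.exp ((t : ℂ) • LinearMap.toContinuousLinearMap G) x := by
  have : CompleteSpace V := FiniteDimensional.complete ℂ V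
  have h := NormedSpace.exp_series_hasSum_exp' (𝕂 := ℂ)
    ((t : ℂ) • LinearMap.toContinuousLinearMap G)
  have h2 := h.mapL (ContinuousLinearMap.apply ℂ V x)
  have hpow : ∀ (m : ℕ) (y : V), (LinearMap.toContinuousLinearMap G ^ m) y = (G ^ m) y := by
    intro m
    induction m with
    | zero => intro y; rfl
    | succ k ih => intro y; rw [pow_succ, pow_succ]; exact ih (G y)
  refine HasSum.tsum_eq ?_
  convert h2 using 1
  · funext m
    rw [smul_pow, smul_smul, ContinuousLinearMap.apply_apply, _root_.smul_apply, hpow]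
    congr 1
    push_cast
    rw [div_eq_inv_mul]
  · rfl

theorem linearFlow_add_of_commute {G H : V →ₗ[ℂ] V} (h : Commute G H) (t : ℝ) (x : V) :
    linearFlow (G + H) t x = linearFlow G t (linearFlow H t x) := by
  have : CompleteSpace V := FiniteDimensional.complete ℂ V
  have hc : Commute (LinearMap.toContinuousLinearMap G) (LinearMap.toContinuousLinearMap H) := by
    ext1 y
    exact LinearMap.congr_fun h.eq y
  -- The addition formula for `NormedSpace.exp` is stated over a `ℚ`-algebra.
  let := NormedAlgebra.restrictScalars ℚ ℂ (V →L[ℂ] V)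
  rw [linearFlow_eq_exp, linearFlow_eq_exp, linearFlow_eq_exp, map_add, smul_add,
    NormedSpace.exp_add_of_commute ((hc.smul_left _).smul_right _)]
  rfl

theorem linearFlow_zero_generator (t : ℝ) (x : V) : linearFlow (0 : V →ₗ[ℂ] V) t x = x := by
  rw [linearFlow_eq_exp, map_zero, smul_zero, NormedSpace.exp_zero]
  rfl

theorem linearFlow_zero_time (G : V →ₗ[ℂ] V) (x : V) : linearFlow G 0 x = x := by
  rw [linearFlow_eq_exp, Complex.ofReal_zero, zero_smul, NormedSpace.exp_zero]
  rfl

theorem linearFlow_smul_of_mul_self {D : V →ₗ[ℂ] V} (hD : D * D = (-2 : ℂ) • D) (c t : ℝ) (x : V) :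
    linearFlow ((c : ℂ) • D) t x = x + (((1 - Real.exp (-2 * t * c)) / 2 : ℝ) : ℂ) • D x := by
  have : CompleteSpace V := FiniteDimensional.complete ℂ V
  have hc : LinearMap.toContinuousLinearMap D * LinearMap.toContinuousLinearMap D
      = (-2 : ℂ) • LinearMap.toContinuousLinearMap D := by
    ext1 y
    exact LinearMap.congr_fun hD y
  rw [linearFlow_eq_exp, map_smul, smul_smul, exp_smul_of_mul_self hc]
  have he : (1 - Complex.exp (-2 * (t * c))) / 2 = (((1 - Real.exp (-2 * t * c)) / 2 : ℝ) : ℂ) := by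
    push_cast
    ring_nf
  rw [he]
  rfl

theorem hasDerivAt_linearFlow_zero (G : V →ₗ[ℂ] V) (x : V) :
    HasDerivAt (fun t : ℝ => linearFlow G t x) (G x) 0 := by
  have : CompleteSpace V := FiniteDimensional.complete ℂ V
  have h := hasDerivAt_exp_smul_const (𝕂 := ℂ) (LinearMap.toContinuousLinearMap G) ((0 : ℝ) : ℂ)
  rw [Complex.ofReal_zero, zero_smul, NormedSpace.exp_zero, one_mul, ← Complex.ofReal_zero] at h
  have h2 := (ContinuousLinearMap.apply ℂ V x).hasFDerivAt.comp_hasDerivAt _ h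
  have h3 := h2.scomp (0 : ℝ) Complex.ofRealCLM.hasDerivAt
  convert h3 using 1
  · funext t
    exact linearFlow_eq_exp G t x
  · simp

end LinearFlow

/-! ### Transfer to matrices, with a norm chosen locally -/

section Flow

variable {ι : Type} [Fintype ι] [DecidableEq ι]

theorem flow_add_of_commute {G H : Matrix ι ι ℂ →ₗ[ℂ] Matrix ι ι ℂ} (h : Commute G H) (t : ℝ)
    (ρ : Matrix ι ι ℂ) : flow (G + H) t ρ = flow G t (flow H t ρ) :=
  letI := Matrix.normedAddCommGroup (m := ι) (n := ι) (α := ℂ)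
  letI := Matrix.normedSpace (m := ι) (n := ι) (α := ℂ) (R := ℂ)
  linearFlow_add_of_commute h t ρ

theorem flow_zero_generator (t : ℝ) (ρ : Matrix ι ι ℂ) : flow 0 t ρ = ρ :=
  letI := Matrix.normedAddCommGroup (m := ι) (n := ι) (α := ℂ)
  letI := Matrix.normedSpace (m := ι) (n := ι) (α := ℂ) (R := ℂ)
  linearFlow_zero_generator t ρ

theorem flow_zero_time (G : Matrix ι ι ℂ →ₗ[ℂ] Matrix ι ι ℂ) (ρ : Matrix ι ι ℂ) :
    flow G 0 ρ = ρ :=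
  letI := Matrix.normedAddCommGroup (m := ι) (n := ι) (α := ℂ)
  letI := Matrix.normedSpace (m := ι) (n := ι) (α := ℂ) (R := ℂ)
  linearFlow_zero_time G ρ

theorem flow_smul_of_mul_self {D : Matrix ι ι ℂ →ₗ[ℂ] Matrix ι ι ℂ} (hD : D * D = (-2 : ℂ) • D)
    (c t : ℝ) (ρ : Matrix ι ι ℂ) :
    flow ((c : ℂ) • D) t ρ = ρ + (((1 - Real.exp (-2 * t * c)) / 2 : ℝ) : ℂ) • D ρ :=
  letI := Matrix.normedAddCommGroup (m := ι) (n := ι) (α := ℂ)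
  letI := Matrix.normedSpace (m := ι) (n := ι) (α := ℂ) (R := ℂ)
  linearFlow_smul_of_mul_self hD c t ρ

theorem hasDerivAt_flow_zero (G : Matrix ι ι ℂ →ₗ[ℂ] Matrix ι ι ℂ) (ρ : Matrix ι ι ℂ)
    (φ : Matrix ι ι ℂ →ₗ[ℝ] ℝ) :
    HasDerivAt (fun t : ℝ => φ (flow G t ρ)) (φ (G ρ)) 0 :=
  letI := Matrix.normedAddCommGroup (m := ι) (n := ι) (α := ℂ)
  letI := Matrix.normedSpace (m := ι) (n := ι) (α := ℂ) (R := ℂ)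
  letI := Matrix.normedSpace (m := ι) (n := ι) (α := ℂ) (R := ℝ)
  (LinearMap.toContinuousLinearMap φ).hasFDerivAt.comp_hasDerivAt (0 : ℝ)
    (hasDerivAt_linearFlow_zero G ρ)

end Flow

/-! ### Pauli channels -/

section Dissipator

variable {ι : Type} [Fintype ι] [DecidableEq ι]

/-- A density operator. -/
def IsDensity (ρ : Matrix ι ι ℂ) : Prop := ρ.PosSemidef ∧ ρ.trace = 1

/-- A Hermitian operator that squares to the identity. -/
def IsHermitianInvolution (P : Matrix ι ι ℂ) : Prop := Pᴴ = P ∧ P * P = 1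

theorem dissipator_apply {P : Matrix ι ι ℂ} (hP : IsHermitianInvolution P) (ρ : Matrix ι ι ℂ) :
    dissipator P ρ = P * ρ * P - ρ := by
  simp only [dissipator, hP.1, hP.2, LinearMap.sub_apply, LinearMap.comp_apply,
    LinearMap.mulLeft_apply, LinearMap.mulRight_apply, LinearMap.smul_apply, LinearMap.add_apply,
    one_mul, mul_one, mul_assoc]
  module

/-- The dissipator is conjugation by `P` minus the identity, and this conjugation is an involution.
-/
theorem dissipator_mul_self {P : Matrix ι ι ℂ} (hP : IsHermitianInvolution P) :
    dissipator P * dissipator P = (-2 : ℂ) • dissipator P := by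
  ext1 ρ
  have h : P * (P * ρ * P) * P = ρ := by
    calc P * (P * ρ * P) * P = (P * P) * ρ * (P * P) := by noncomm_ring
      _ = ρ := by rw [hP.2, one_mul, mul_one]
  rw [Module.End.mul_apply, LinearMap.smul_apply, dissipator_apply hP, dissipator_apply hP, mul_sub,
    sub_mul, h]
  module

/-- Conjugation sees the sign `c` twice, so it cancels because `c * c = 1`. -/
theorem dissipator_commute {P Q : Matrix ι ι ℂ} (hP : IsHermitianInvolution P)
    (hQ : IsHermitianInvolution Q) (hPQ : ∃ c : ℂ, c * c = 1 ∧ P * Q = c • (Q * P)) :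
    Commute (dissipator P) (dissipator Q) := by
  obtain ⟨c, hc, h⟩ := hPQ
  have h' : Q * P = c • (P * Q) := by rw [h, smul_smul, hc, one_smul]
  ext1 ρ
  have hcomm : P * (Q * ρ * Q) * P = Q * (P * ρ * P) * Q := by
    calc P * (Q * ρ * Q) * P = (P * Q) * ρ * (Q * P) := by noncomm_ring
      _ = (c * c) • ((Q * P) * ρ * (P * Q)) := by
        rw [show P * Q * ρ * (Q * P) = (c • (Q * P)) * ρ * (c • (P * Q)) from
          congrArg₂ (fun A B => A * ρ * B) h h']
        simp only [smul_mul_assoc, mul_smul_comm, smul_smul]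
      _ = Q * (P * ρ * P) * Q := by rw [hc, one_smul]; noncomm_ring
  rw [Module.End.mul_apply, Module.End.mul_apply, dissipator_apply hP, dissipator_apply hQ,
    dissipator_apply hP, dissipator_apply hQ, mul_sub, sub_mul, mul_sub, sub_mul, hcomm]
  abel

/-- The convex combination with weight `q` of an operator and its conjugate by `P`. -/
def pauliMix (P : Matrix ι ι ℂ) (q : ℝ) (ρ : Matrix ι ι ℂ) : Matrix ι ι ℂ :=
  ((1 - q : ℝ) : ℂ) • ρ + (q : ℂ) • (P * ρ * P)

/-- The probability that the jump `P` has acted an odd number of times. -/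
noncomputable def flipProb (t c : ℝ) : ℝ := (1 - Real.exp (-2 * t * c)) / 2

theorem flipProb_nonneg {t c : ℝ} (ht : 0 ≤ t) (hc : 0 ≤ c) : 0 ≤ flipProb t c := by
  have : Real.exp (-2 * t * c) ≤ 1 := Real.exp_le_one_iff.2 (by nlinarith [mul_nonneg ht hc])
  unfold flipProb
  linarith

theorem flipProb_pos {t c : ℝ} (ht : 0 < t) (hc : 0 < c) : 0 < flipProb t c := by
  have : Real.exp (-2 * t * c) < 1 := by
    rw [← Real.exp_zero, Real.exp_lt_exp]
    nlinarith [mul_pos ht hc]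
  unfold flipProb
  linarith

theorem flipProb_lt_one (t c : ℝ) : flipProb t c < 1 := by
  have := Real.exp_pos (-2 * t * c)
  unfold flipProb
  linarith

theorem flow_smul_dissipator {P : Matrix ι ι ℂ} (hP : IsHermitianInvolution P) (c t : ℝ)
    (ρ : Matrix ι ι ℂ) : flow ((c : ℂ) • dissipator P) t ρ = pauliMix P (flipProb t c) ρ := by
  rw [flow_smul_of_mul_self (dissipator_mul_self hP), dissipator_apply hP, pauliMix, flipProb]
  push_cast
  module

theorem IsDensity.conj {P ρ : Matrix ι ι ℂ} (hρ : IsDensity ρ) (hP : IsHermitianInvolution P) :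
    IsDensity (P * ρ * P) := by
  refine ⟨?_, ?_⟩
  · have h := hρ.1.mul_mul_conjTranspose_same P
    rwa [hP.1] at h
  · rw [Matrix.trace_mul_comm, ← mul_assoc, hP.2, one_mul, hρ.2]

theorem IsDensity.pauliMix {P ρ : Matrix ι ι ℂ} (hρ : IsDensity ρ) (hP : IsHermitianInvolution P)
    {q : ℝ} (h0 : 0 ≤ q) (h1 : q ≤ 1) : IsDensity (pauliMix P q ρ) := by
  have hc := hρ.conj hP
  refine ⟨(hρ.1.smul ?_).add (hc.1.smul ?_), ?_⟩
  · exact_mod_cast sub_nonneg.2 h1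
  · exact_mod_cast h0
  · rw [LindbladEstimation.pauliMix, Matrix.trace_add, Matrix.trace_smul, Matrix.trace_smul, hρ.2,
      hc.2]
    simp

variable {N : ℕ} {S : Matrix ι ι ℂ} {L : Fin N → Matrix ι ι ℂ} {γ : Fin N → ℝ}

theorem isDensity_flow_noise (hL : ∀ k, IsHermitianInvolution (L k))
    (hLL : ∀ j k, ∃ c : ℂ, c * c = 1 ∧ L j * L k = c • (L k * L j)) (hγ : ∀ k, 0 < γ k)
    {t : ℝ} (ht : 0 ≤ t) (s : Finset (Fin N)) {ρ : Matrix ι ι ℂ} (hρ : IsDensity ρ) :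
    IsDensity (flow (∑ k ∈ s, (γ k : ℂ) • dissipator (L k)) t ρ) := by
  induction s using Finset.induction_on with
  | empty => rwa [Finset.sum_empty, flow_zero_generator]
  | insert a s ha ih =>
    rw [Finset.sum_insert ha, flow_add_of_commute, flow_smul_dissipator (hL a)]
    · exact ih.pauliMix (hL a) (flipProb_nonneg ht (hγ a).le) (flipProb_lt_one _ _).le
    · refine Commute.sum_right _ _ _ fun k _ => ?_
      exact ((dissipator_commute (hL a) (hL k) (hLL a k)).smul_left _).smul_right _

/-- This isolates `θ` in the scalar `flipProb`; the inner noise flow does not involve it. -/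
theorem flow_generator (hS : IsHermitianInvolution S) (hL : ∀ k, IsHermitianInvolution (L k))
    (hSL : ∀ k, ∃ c : ℂ, c * c = 1 ∧ S * L k = c • (L k * S)) (t θ : ℝ) (ρ : Matrix ι ι ℂ) :
    flow (generator S L γ θ) t ρ = pauliMix S (flipProb t (θ ^ 2))
      (flow (∑ k, (γ k : ℂ) • dissipator (L k)) t ρ) := by
  rw [generator, flow_add_of_commute, flow_smul_dissipator hS]
  refine Commute.sum_right _ _ _ fun k _ => ?_
  exact ((dissipator_commute hS (hL k) (hSL k)).smul_left _).smul_right _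

end Dissipator

/-! ### Upper bounds on the quantum Fisher information -/

section UpperBound

variable {ι : Type} [Fintype ι] [DecidableEq ι]

open scoped MatrixOrder in
theorem trace_mul_re_nonneg {A B : Matrix ι ι ℂ} (hA : A.PosSemidef) (hB : B.PosSemidef) :
    0 ≤ (A * B).trace.re := by
  obtain ⟨C, rfl⟩ := CStarAlgebra.nonneg_iff_eq_star_mul_self.mp hA.nonneg
  rw [mul_assoc, Matrix.trace_mul_comm, Matrix.star_eq_conjTranspose]
  exact (Complex.nonneg_iff.1 (hB.mul_mul_conjTranspose_same C).trace_nonneg).1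

/-- Near `θ`, the state is a mixture of fixed states, whose weights have classical Fisher
information `F` at `θ`. -/
def HasMixtureInformation (ρ : ℝ → Matrix ι ι ℂ) (θ F : ℝ) : Prop :=
  ∃ (κ : Type) (_ : Fintype κ) (w : ℝ → κ → ℝ) (w' : κ → ℝ) (A : κ → Matrix ι ι ℂ),
    (∀ θ', ρ θ' = ∑ x, (w θ' x : ℂ) • A x) ∧ (∀ x, HasDerivAt (fun θ' => w θ' x) (w' x) θ) ∧
    (∀ x, 0 < w θ x) ∧ ∑ x, w θ x = 1 ∧ ∑ x, w' x = 0 ∧ (∀ x, IsDensity (A x)) ∧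
    ∑ x, w' x ^ 2 / w θ x = F

/-- Data processing: a measurement post-processes the mixture label through the stochastic matrix
`e`. Cauchy–Schwarz bounds each outcome's term, and the rows of `e` sum to one. -/
theorem HasMixtureInformation.qfi_le {ρ : ℝ → Matrix ι ι ℂ} {θ F : ℝ}
    (h : HasMixtureInformation ρ θ F) : qfi ρ θ ≤ ENNReal.ofReal F := by
  obtain ⟨κ, _, w, w', A, hρ, hw, hpos, -, -, hA, hF⟩ := h
  refine iSup_le fun k => iSup_le fun E => ENNReal.ofReal_le_ofReal ?_
  set e : κ → Fin k → ℝ := fun x j => E.prob (A x) j with he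
  have he0 : ∀ x j, 0 ≤ e x j := fun x j => trace_mul_re_nonneg (hA x).1 (E.posSemidef j)
  have he1 : ∀ x, ∑ j, e x j = 1 := by
    intro x
    simp only [he, POVM.prob]
    rw [← Complex.re_sum, ← Matrix.trace_sum, ← Finset.mul_sum, E.sum_eq_one, mul_one, (hA x).2,
      Complex.one_re]
  have hp : ∀ j θ', E.prob (ρ θ') j = ∑ x, w θ' x * e x j := by
    intro j θ'
    simp only [he, POVM.prob]
    rw [hρ, Finset.sum_mul, Matrix.trace_sum, Complex.re_sum]
    refine Finset.sum_congr rfl fun x _ => ?_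
    rw [smul_mul_assoc, Matrix.trace_smul, smul_eq_mul, Complex.re_ofReal_mul]
  have hd : ∀ j, deriv (fun θ' => E.prob (ρ θ') j) θ = ∑ x, w' x * e x j := by
    intro j
    simp only [hp]
    exact (HasDerivAt.fun_sum fun x _ => (hw x).mul_const (e x j)).deriv
  have hj : ∀ j, (deriv (fun θ' => E.prob (ρ θ') j) θ) ^ 2 / E.prob (ρ θ) j
      ≤ ∑ x, w' x ^ 2 / w θ x * e x j := by
    intro j
    rw [hd, hp]
    have hf0 : ∀ x ∈ Finset.univ, 0 ≤ w' x ^ 2 / w θ x * e x j := fun x _ =>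
      mul_nonneg (div_nonneg (sq_nonneg _) (hpos x).le) (he0 x j)
    have hg0 : ∀ x ∈ Finset.univ, 0 ≤ w θ x * e x j := fun x _ =>
      mul_nonneg (hpos x).le (he0 x j)
    refine div_le_of_le_mul₀ (Finset.sum_nonneg hg0) (Finset.sum_nonneg hf0) ?_
    refine Finset.sum_sq_le_sum_mul_sum_of_sq_le_mul _ hf0 hg0 fun x _ => le_of_eq ?_
    have := (hpos x).ne'
    field_simp
  calc cfi (fun θ' => E.prob (ρ θ')) θ ≤ ∑ j, ∑ x, w' x ^ 2 / w θ x * e x j :=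
        Finset.sum_le_sum fun j _ => hj j
    _ = F := by
        rw [Finset.sum_comm, ← hF]
        simp only [← Finset.mul_sum, he1, mul_one]

theorem hasMixtureInformation_const {ρ : Matrix ι ι ℂ} (hρ : IsDensity ρ) (θ : ℝ) :
    HasMixtureInformation (fun _ => ρ) θ 0 :=
  ⟨Unit, inferInstance, fun _ _ => 1, fun _ => 0, fun _ => ρ, by simp,
    fun _ => hasDerivAt_const _ _, by simp, by simp, by simp, fun _ => hρ, by simp⟩

theorem IsDensity.apply {ρ : Matrix ι ι ℂ} (hρ : IsDensity ρ) (C : Channel ι) :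
    IsDensity (C.apply ρ) := by
  refine ⟨Matrix.posSemidef_sum _ fun j _ => hρ.1.mul_mul_conjTranspose_same _, ?_⟩
  have : (C.apply ρ).trace = ((∑ j, (C.kraus j)ᴴ * C.kraus j) * ρ).trace := by
    rw [Channel.apply, Finset.sum_mul, Matrix.trace_sum, Matrix.trace_sum]
    refine Finset.sum_congr rfl fun j _ => ?_
    rw [Matrix.trace_mul_comm, mul_assoc]
  rw [this, C.sum_eq_one, one_mul, hρ.2]

theorem HasMixtureInformation.apply {ρ : ℝ → Matrix ι ι ℂ} {θ F : ℝ}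
    (h : HasMixtureInformation ρ θ F) (C : Channel ι) :
    HasMixtureInformation (fun θ' => C.apply (ρ θ')) θ F := by
  obtain ⟨κ, _, w, w', A, hρ, hw, hpos, hw1, hw0, hA, hF⟩ := h
  refine ⟨κ, inferInstance, w, w', fun x => C.apply (A x), fun θ' => ?_, hw, hpos, hw1, hw0,
    fun x => (hA x).apply C, hF⟩
  simp only [hρ, Channel.apply, Finset.mul_sum, Finset.sum_mul, Finset.smul_sum, mul_smul_comm,
    smul_mul_assoc]
  exact Finset.sum_comm

/-- An independent flip multiplies the weights by those of a Bernoulli variable, whose Fisher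
information is `q'² / (q (1 - q))`. The cross terms of the two branches cancel for each `x`. -/
theorem HasMixtureInformation.pauliMix {ρ : ℝ → Matrix ι ι ℂ} {θ F : ℝ}
    (h : HasMixtureInformation ρ θ F) {P : Matrix ι ι ℂ} (hP : IsHermitianInvolution P)
    {q : ℝ → ℝ} {q' : ℝ} (hq : HasDerivAt q q' θ) (h0 : 0 < q θ) (h1 : q θ < 1) :
    HasMixtureInformation (fun θ' => pauliMix P (q θ') (ρ θ')) θ
      (F + q' ^ 2 / (q θ * (1 - q θ))) := by
  obtain ⟨κ, _, w, w', A, hρ, hw, hpos, hw1, hw0, hA, hF⟩ := h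
  have h2 : 0 < 1 - q θ := sub_pos.2 h1
  refine ⟨κ ⊕ κ, inferInstance,
    fun θ' => Sum.elim (fun x => (1 - q θ') * w θ' x) (fun x => q θ' * w θ' x),
    Sum.elim (fun x => -q' * w θ x + (1 - q θ) * w' x) (fun x => q' * w θ x + q θ * w' x),
    Sum.elim A (fun x => P * A x * P), fun θ' => ?_, ?_, ?_, ?_, ?_, ?_, ?_⟩
  · simp only [LindbladEstimation.pauliMix, hρ, Fintype.sum_sum_type, Sum.elim_inl, Sum.elim_inr,
      Finset.mul_sum, Finset.sum_mul, Finset.smul_sum, mul_smul_comm, smul_mul_assoc, smul_smul,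
      Complex.ofReal_mul]
  · rintro (x | x)
    · exact (hq.const_sub 1).mul (hw x)
    · exact hq.mul (hw x)
  · rintro (x | x)
    · exact mul_pos h2 (hpos x)
    · exact mul_pos h0 (hpos x)
  · simp [← Finset.mul_sum, hw1]
  · simp [Finset.sum_add_distrib, ← Finset.mul_sum, hw1, hw0]
  · rintro (x | x)
    · exact hA x
    · exact (hA x).conj hP
  · simp only [Fintype.sum_sum_type, Sum.elim_inl, Sum.elim_inr]
    have hx : ∀ x, (-q' * w θ x + (1 - q θ) * w' x) ^ 2 / ((1 - q θ) * w θ x)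
        + (q' * w θ x + q θ * w' x) ^ 2 / (q θ * w θ x)
        = w' x ^ 2 / w θ x + q' ^ 2 / (q θ * (1 - q θ)) * w θ x := by
      intro x
      have h3 := (hpos x).ne'
      have h4 := h0.ne'
      have h5 := h2.ne'
      field_simp
      ring
    rw [← Finset.sum_add_distrib, Finset.sum_congr rfl fun x _ => hx x, Finset.sum_add_distrib, hF,
      ← Finset.mul_sum, hw1, mul_one]

theorem HasMixtureInformation.qfi_le_of_le {ρ : ℝ → Matrix ι ι ℂ} {θ F F' : ℝ}
    (h : HasMixtureInformation ρ θ F) (hF : F ≤ F') : qfi ρ θ ≤ ENNReal.ofReal F' :=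
  h.qfi_le.trans (ENNReal.ofReal_le_ofReal hF)

/-! ### Fisher information of a single flip -/

theorem hasDerivAt_flipProb (t θ : ℝ) :
    HasDerivAt (fun θ' => flipProb t (θ' ^ 2)) (2 * t * θ * Real.exp (-2 * t * θ ^ 2)) θ := by
  have h1 : HasDerivAt (fun θ' : ℝ => -2 * t * θ' ^ 2) (-2 * t * (2 * θ)) θ := by
    simpa using (hasDerivAt_pow 2 θ).const_mul (-2 * t)
  have h2 := (h1.exp.const_sub 1).div_const 2
  refine h2.congr_deriv ?_
  ring

/-- The Fisher information of a single flip. -/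
noncomputable def flipInfo (t θ : ℝ) : ℝ :=
  (2 * t * θ * Real.exp (-2 * t * θ ^ 2)) ^ 2 /
    (flipProb t (θ ^ 2) * (1 - flipProb t (θ ^ 2)))

theorem flipInfo_le {t θ : ℝ} (ht : 0 < t) (hθ : 0 < θ) : flipInfo t θ ≤ 4 * t := by
  have h0 := flipProb_pos ht (pow_pos hθ 2)
  have h1 := flipProb_lt_one t (θ ^ 2)
  rw [flipInfo, div_le_iff₀ (mul_pos h0 (sub_pos.2 h1))]
  set x := -2 * t * θ ^ 2 with hx
  -- Since `q (1 - q) = (1 - exp (2x)) / 4`, the claim is equivalent to `1 - 2x ≤ exp (-2x)`.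
  have hexp : Real.exp x ^ 2 * (1 - 2 * x) ≤ 1 := by
    have h2 : -(2 * x) + 1 ≤ Real.exp (-(2 * x)) := Real.add_one_le_exp _
    have h3 : Real.exp x ^ 2 * Real.exp (-(2 * x)) = 1 := by
      rw [← Real.exp_nat_mul, ← Real.exp_add]
      simp
    nlinarith [sq_nonneg (Real.exp x)]
  have hq : flipProb t (θ ^ 2) = (1 - Real.exp x) / 2 := rfl
  rw [hq]
  have h5 : (2 * t * θ * Real.exp x) ^ 2 = t * (-2 * x) * Real.exp x ^ 2 := by
    rw [hx]; ring
  rw [h5]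
  nlinarith

theorem pauliMix_qfi_le {σ P : Matrix ι ι ℂ} (hσ : IsDensity σ) (hP : IsHermitianInvolution P)
    {t θ : ℝ} (ht : 0 < t) (hθ : 0 < θ) :
    qfi (fun θ' => pauliMix P (flipProb t (θ' ^ 2)) σ) θ ≤ ENNReal.ofReal (4 * t) := by
  refine ((hasMixtureInformation_const hσ θ).pauliMix hP (hasDerivAt_flipProb t θ)
    (flipProb_pos ht (pow_pos hθ 2)) (flipProb_lt_one t _)).qfi_le_of_le ?_
  rw [zero_add]
  exact flipInfo_le ht hθ

/-! ### Noiseless sequential strategies -/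

theorem isHermitianInvolution_kronecker_one {S : Matrix ι ι ℂ} (hS : IsHermitianInvolution S)
    (a : ℕ) : IsHermitianInvolution (S ⊗ₖ (1 : Matrix (Fin a) (Fin a) ℂ)) := by
  refine ⟨?_, ?_⟩
  · rw [Matrix.conjTranspose_kronecker, hS.1, Matrix.conjTranspose_one]
  · rw [← Matrix.mul_kronecker_mul, hS.2, mul_one, Matrix.one_kronecker_one]

theorem flow_generator_noiseless {S : Matrix ι ι ℂ} (hS : IsHermitianInvolution S)
    (L : Fin 0 → Matrix ι ι ℂ) (γ : Fin 0 → ℝ) (t θ : ℝ) (ρ : Matrix ι ι ℂ) :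
    flow (generator S L γ θ) t ρ = pauliMix S (flipProb t (θ ^ 2)) ρ := by
  rw [flow_generator hS (fun k => k.elim0) (fun k => k.elim0), Fin.sum_univ_zero,
    flow_zero_generator]

theorem hasMixtureInformation_state {S : Matrix ι ι ℂ} (hS : IsHermitianInvolution S) {a : ℕ}
    (C : SequentialStrategy ι a) (L : Fin 0 → Matrix ι ι ℂ) (γ : Fin 0 → ℝ) {t θ : ℝ}
    (ht : 0 < t) (hθ : 0 < θ) (m : ℕ) :
    HasMixtureInformation (fun θ' => C.state S L γ t θ' m) θ (m * flipInfo t θ) := by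
  induction m with
  | zero =>
    rw [Nat.cast_zero, zero_mul]
    exact hasMixtureInformation_const ⟨C.init_posSemidef, C.init_trace⟩ θ
  | succ m ih =>
    have hS' := isHermitianInvolution_kronecker_one hS a
    rw [Nat.cast_succ, add_mul, one_mul]
    simp only [SequentialStrategy.state, flow_generator_noiseless hS']
    exact (ih.pauliMix hS' (hasDerivAt_flipProb t θ) (flipProb_pos ht (pow_pos hθ 2))
      (flipProb_lt_one t _)).apply _

theorem optimalQFI_le {S : Matrix ι ι ℂ} (hS : IsHermitianInvolution S) (L : Fin 0 → Matrix ι ι ℂ)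
    (γ : Fin 0 → ℝ) {T θ : ℝ} (hT : 0 < T) (hθ : 0 < θ) :
    optimalQFI S L γ T θ ≤ ENNReal.ofReal (4 * T) := by
  refine iSup_le fun M => iSup_le fun hM => iSup_le fun a => iSup_le fun C => ?_
  have hM' : (0 : ℝ) < M := by exact_mod_cast hM
  have ht : 0 < T / M := div_pos hT hM'
  refine (hasMixtureInformation_state hS C L γ ht hθ M).qfi_le_of_le ?_
  calc (M : ℝ) * flipInfo (T / M) θ ≤ M * (4 * (T / M)) :=
        mul_le_mul_of_nonneg_left (flipInfo_le ht hθ) hM'.le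
    _ = 4 * T := by field_simp

end UpperBound

/-! ### Lower bounds on the quantum Fisher information -/

section LowerBound

variable {ι : Type} [Fintype ι] [DecidableEq ι]

theorem pureState_posSemidef (v : ι → ℂ) : (pureState v).PosSemidef :=
  Matrix.posSemidef_vecMulVec_self_star v

theorem isDensity_pureState {v : ι → ℂ} (hv : star v ⬝ᵥ v = 1) : IsDensity (pureState v) := by
  refine ⟨pureState_posSemidef v, ?_⟩
  rw [pureState, Matrix.trace_vecMulVec, dotProduct_comm, hv]

theorem pureState_mul_self {v : ι → ℂ} (hv : star v ⬝ᵥ v = 1) :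
    pureState v * pureState v = pureState v := by
  rw [pureState, Matrix.vecMulVec_mul_vecMulVec, hv, one_smul]

theorem conj_pureState {S : Matrix ι ι ℂ} (hS : Sᴴ = S) (v : ι → ℂ) :
    S * pureState v * S = pureState (S *ᵥ v) := by
  rw [pureState, pureState, Matrix.mul_vecMulVec, Matrix.vecMulVec_mul, Matrix.star_mulVec, hS]

/-- The measurement that tests whether the state is `v`. -/
def projectivePOVM (v : ι → ℂ) (hv : star v ⬝ᵥ v = 1) : POVM ι 2 where
  effect := ![pureState v, 1 - pureState v]
  posSemidef := by
    have h : (1 - pureState v : Matrix ι ι ℂ) = (1 - pureState v)ᴴ * (1 - pureState v) := by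
      rw [Matrix.conjTranspose_sub, Matrix.conjTranspose_one, (pureState_posSemidef v).1.eq,
        sub_mul, mul_sub, mul_sub, pureState_mul_self hv]
      simp
    intro j
    fin_cases j
    · exact pureState_posSemidef v
    · change (1 - pureState v).PosSemidef
      rw [h]
      exact Matrix.posSemidef_conjTranspose_mul_self _
  sum_eq_one := by simp [Fin.sum_univ_two]

/-- The probability of finding the state `v`. -/
def overlap (v : ι → ℂ) : Matrix ι ι ℂ →ₗ[ℝ] ℝ where
  toFun ρ := (ρ * pureState v).trace.re
  map_add' ρ σ := by simp [add_mul]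
  map_smul' c ρ := by simp

theorem overlap_ofReal_smul (v : ι → ℂ) (c : ℝ) (ρ : Matrix ι ι ℂ) :
    overlap v ((c : ℂ) • ρ) = c * overlap v ρ :=
  (overlap v).map_smul c ρ

theorem overlap_conj {S : Matrix ι ι ℂ} (hS : Sᴴ = S) (v : ι → ℂ) (ρ : Matrix ι ι ℂ) :
    overlap v (S * ρ * S) = overlap (S *ᵥ v) ρ := by
  change (S * ρ * S * pureState v).trace.re = (ρ * pureState (S *ᵥ v)).trace.re
  rw [← conj_pureState hS, mul_assoc, mul_assoc, Matrix.trace_mul_comm]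
  simp only [mul_assoc]

theorem overlap_pauliMix {S : Matrix ι ι ℂ} (hS : Sᴴ = S) (v : ι → ℂ) (q : ℝ) (ρ : Matrix ι ι ℂ) :
    overlap v (pauliMix S q ρ) = (1 - q) * overlap v ρ + q * overlap (S *ᵥ v) ρ := by
  rw [pauliMix, map_add, overlap_ofReal_smul, overlap_ofReal_smul, overlap_conj hS]

theorem overlap_pureState (v ψ : ι → ℂ) :
    overlap v (pureState ψ) = Complex.normSq (star v ⬝ᵥ ψ) := by
  change (pureState ψ * pureState v).trace.re = _
  rw [pureState, pureState, Matrix.vecMulVec_mul_vecMulVec, Matrix.vecMulVec_smul,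
    Matrix.trace_smul, Matrix.trace_vecMulVec, dotProduct_comm ψ, smul_eq_mul]
  have h : star ψ ⬝ᵥ v = star (star v ⬝ᵥ ψ) := by
    rw [Matrix.star_dotProduct]
  rw [h, Complex.star_def, ← Complex.normSq_eq_conj_mul_self, Complex.ofReal_re]

/-- Only the outcome `v` of the test is kept; the other contributes a nonnegative term. -/
theorem le_qfi_of_overlap {ρ : ℝ → Matrix ι ι ℂ} {θ p' : ℝ} (hρ : (ρ θ).PosSemidef)
    {v : ι → ℂ} (hv : star v ⬝ᵥ v = 1) (hp : HasDerivAt (fun θ' => overlap v (ρ θ')) p' θ) :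
    ENNReal.ofReal (p' ^ 2 / overlap v (ρ θ)) ≤ qfi ρ θ := by
  refine le_trans (ENNReal.ofReal_le_ofReal ?_)
    (le_iSup₂_of_le 2 (projectivePOVM v hv) le_rfl)
  rw [cfi, Fin.sum_univ_two]
  have h0 : deriv (fun θ' => (projectivePOVM v hv).prob (ρ θ') 0) θ = p' := hp.deriv
  rw [h0]
  refine le_add_of_nonneg_right (div_nonneg (sq_nonneg _) ?_)
  exact trace_mul_re_nonneg hρ ((projectivePOVM v hv).posSemidef 1)

theorem star_mulVec_dotProduct_mulVec {S : Matrix ι ι ℂ} (hS : IsHermitianInvolution S)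
    (u v : ι → ℂ) : star (S *ᵥ u) ⬝ᵥ (S *ᵥ v) = star u ⬝ᵥ v := by
  rw [Matrix.star_mulVec, hS.1, Matrix.dotProduct_mulVec, Matrix.vecMul_vecMul, hS.2,
    Matrix.vecMul_one]

/-- The test is for `Sψ`, the state reached from `ψ` by a signal jump. Since `S` is an involution,
the flipped branch contributes the overlap with `ψ`. -/
theorem le_pauliMix_qfi {σ S : Matrix ι ι ℂ} (hσ : IsDensity σ) (hS : IsHermitianInvolution S)
    {ψ : ι → ℂ} (hψ : star ψ ⬝ᵥ ψ = 1) {t : ℝ} (ht : 0 ≤ t) (θ : ℝ) :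
    ENNReal.ofReal ((2 * t * θ * Real.exp (-2 * t * θ ^ 2) *
      (overlap ψ σ - overlap (S *ᵥ ψ) σ)) ^ 2 /
      ((1 - flipProb t (θ ^ 2)) * overlap (S *ᵥ ψ) σ + flipProb t (θ ^ 2) * overlap ψ σ)) ≤
    qfi (fun θ' => pauliMix S (flipProb t (θ' ^ 2)) σ) θ := by
  have hSS : S *ᵥ (S *ᵥ ψ) = ψ := by rw [Matrix.mulVec_mulVec, hS.2, Matrix.one_mulVec]
  have hv : star (S *ᵥ ψ) ⬝ᵥ (S *ᵥ ψ) = 1 := by rw [star_mulVec_dotProduct_mulVec hS, hψ]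
  have hρ : (pauliMix S (flipProb t (θ ^ 2)) σ).PosSemidef :=
    (hσ.pauliMix hS (flipProb_nonneg ht (sq_nonneg θ)) (flipProb_lt_one _ _).le).1
  have hq := hasDerivAt_flipProb t θ
  have h := le_qfi_of_overlap (ρ := fun θ' => pauliMix S (flipProb t (θ' ^ 2)) σ) (θ := θ)
    (p' := 2 * t * θ * Real.exp (-2 * t * θ ^ 2) * (overlap ψ σ - overlap (S *ᵥ ψ) σ)) hρ hv ?_
  · simpa only [overlap_pauliMix hS.1, hSS] using h
  · simp only [overlap_pauliMix hS.1, hSS]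
    refine (((hq.const_sub 1).mul_const _).add (hq.mul_const _)).congr_deriv ?_
    ring

theorem tendsto_flipProb_div (c : ℝ) :
    Tendsto (fun t => flipProb t c / t) (𝓝[>] 0) (𝓝 c) := by
  have h : HasDerivAt (fun t => flipProb t c) c 0 := by
    have h1 : HasDerivAt (fun t : ℝ => -2 * t * c) (-2 * c) 0 := by
      simpa using ((hasDerivAt_id (0 : ℝ)).const_mul (-2)).mul_const c
    refine ((h1.exp.const_sub 1).div_const 2).congr_deriv ?_
    simp
  have h2 := h.tendsto_slope_zero_right
  refine h2.congr fun t => ?_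
  simp [flipProb, div_eq_inv_mul]

/-- By this symmetry the limit for short times also serves for weak signals at fixed time. -/
theorem flipProb_comm (t c : ℝ) : flipProb t c = flipProb c t := by
  rw [flipProb, flipProb, mul_right_comm]

theorem tendsto_flipProb (c : ℝ) : Tendsto (fun t => flipProb t c) (𝓝[>] 0) (𝓝 0) := by
  have h : Continuous fun t => flipProb t c := by unfold flipProb; fun_prop
  convert ((h.tendsto 0).mono_left nhdsWithin_le_nhds) using 2
  simp [flipProb]

/-! ### Measure-and-reset -/

variable {N : ℕ} {S : Matrix ι ι ℂ} {L : Fin N → Matrix ι ι ℂ} {γ : Fin N → ℝ} {ψ : ι → ℂ}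

/-- Up to the rate, each noise operator contributes `|⟨Sψ, L k ψ⟩|² - |⟨Sψ, ψ⟩|²`. Hence noise leaks
into `Sψ` only beyond first order in time. -/
theorem overlap_noise_eq_zero (hL : ∀ k, IsHermitianInvolution (L k))
    (h0 : star (S *ᵥ ψ) ⬝ᵥ ψ = 0) (hk : ∀ k, star (S *ᵥ ψ) ⬝ᵥ (L k *ᵥ ψ) = 0) :
    overlap (S *ᵥ ψ) ((∑ k, (γ k : ℂ) • dissipator (L k)) (pureState ψ)) = 0 := by
  rw [LinearMap.sum_apply, map_sum]
  refine Finset.sum_eq_zero fun k _ => ?_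
  rw [LinearMap.smul_apply, overlap_ofReal_smul, dissipator_apply (hL k), conj_pureState (hL k).1,
    map_sub, overlap_pureState, overlap_pureState, h0, hk]
  simp

theorem isMeasureResetQFI_of_orthogonal (hS : IsHermitianInvolution S)
    (hL : ∀ k, IsHermitianInvolution (L k))
    (hSL : ∀ k, ∃ c : ℂ, c * c = 1 ∧ S * L k = c • (L k * S))
    (hLL : ∀ j k, ∃ c : ℂ, c * c = 1 ∧ L j * L k = c • (L k * L j)) (hγ : ∀ k, 0 < γ k)
    (hψ : star ψ ⬝ᵥ ψ = 1) (h0 : star (S *ᵥ ψ) ⬝ᵥ ψ = 0)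
    (hk : ∀ k, star (S *ᵥ ψ) ⬝ᵥ (L k *ᵥ ψ) = 0) {T : ℝ} (hT : 0 < T) :
    IsMeasureResetQFI S L γ ψ T (ENNReal.ofReal (4 * T)) := by
  -- The limit `M → ∞` already equals `4T` at every `θ > 0`, so `J` is constant.
  refine ⟨fun _ => ENNReal.ofReal (4 * T), fun θ hθ => ?_, tendsto_const_nhds⟩
  set σ : ℝ → Matrix ι ι ℂ := fun t =>
    flow (∑ k, (γ k : ℂ) • dissipator (L k)) t (pureState ψ) with hσ
  have hσd : ∀ t, 0 ≤ t → IsDensity (σ t) := fun t ht =>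
    isDensity_flow_noise hL hLL hγ ht _ (isDensity_pureState hψ)
  have hflow : ∀ t, (fun θ' => flow (generator S L γ θ') t (pureState ψ)) =
      fun θ' => pauliMix S (flipProb t (θ' ^ 2)) (σ t) := fun t =>
    funext fun θ' => flow_generator hS hL hSL t θ' _
  set a : ℝ → ℝ := fun t => overlap (S *ᵥ ψ) (σ t) with ha
  set b : ℝ → ℝ := fun t => overlap ψ (σ t) with hb
  have hda : HasDerivAt a 0 0 := by
    have := hasDerivAt_flow_zero (∑ k, (γ k : ℂ) • dissipator (L k)) (pureState ψ)
      (overlap (S *ᵥ ψ))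
    rwa [overlap_noise_eq_zero hL h0 hk] at this
  have hdb := hasDerivAt_flow_zero (∑ k, (γ k : ℂ) • dissipator (L k)) (pureState ψ) (overlap ψ)
  have ha0 : a 0 = 0 := by
    simp [ha, hσ, flow_zero_time, overlap_pureState, h0]
  have hb0 : b 0 = 1 := by
    simp [hb, hσ, flow_zero_time, overlap_pureState, hψ]
  have hta : Tendsto a (𝓝[>] 0) (𝓝 0) :=
    (ha0 ▸ hda.continuousAt.tendsto).mono_left nhdsWithin_le_nhds
  have htb : Tendsto b (𝓝[>] 0) (𝓝 1) :=
    (hb0 ▸ (show HasDerivAt b _ 0 from hdb).continuousAt.tendsto).mono_left nhdsWithin_le_nhds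
  have htad : Tendsto (fun t => a t / t) (𝓝[>] 0) (𝓝 0) := by
    refine hda.tendsto_slope_zero_right.congr fun t => ?_
    rw [zero_add, ha0, sub_zero, smul_eq_mul, div_eq_inv_mul]
  -- The bound of `le_pauliMix_qfi` per unit time. As `t → 0` its numerator tends to `4θ²` and its
  -- denominator to `θ²`, since `a t / t → 0`.
  set g : ℝ → ℝ := fun t => (2 * θ * Real.exp (-2 * t * θ ^ 2) * (b t - a t)) ^ 2 /
    ((1 - flipProb t (θ ^ 2)) * (a t / t) + flipProb t (θ ^ 2) / t * b t) with hg
  have hexp : Tendsto (fun t : ℝ => Real.exp (-2 * t * θ ^ 2)) (𝓝[>] 0) (𝓝 1) := by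
    have h : Continuous fun t : ℝ => Real.exp (-2 * t * θ ^ 2) := by fun_prop
    convert ((h.tendsto 0).mono_left nhdsWithin_le_nhds) using 2
    simp
  have hgt : Tendsto g (𝓝[>] 0) (𝓝 4) := by
    have h := (((hexp.const_mul (2 * θ)).mul (htb.sub hta)).pow 2).div
      ((((tendsto_flipProb (θ ^ 2)).const_sub 1).mul htad).add
        ((tendsto_flipProb_div (θ ^ 2)).mul htb)) (by simp [hθ.ne'])
    have h4 : (2 * θ * 1 * (1 - 0)) ^ 2 / ((1 - 0) * 0 + θ ^ 2 * 1) = 4 := by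
      rw [div_eq_iff (by simp [hθ.ne'])]
      ring
    rw [h4] at h
    exact h
  have htM : Tendsto (fun M : ℕ => T / (M : ℝ)) atTop (𝓝[>] 0) := by
    refine tendsto_nhdsWithin_iff.2 ⟨tendsto_const_div_atTop_nhds_zero_nat T, ?_⟩
    filter_upwards [eventually_gt_atTop 0] with M hM
    exact div_pos hT (by exact_mod_cast hM)
  have hlow : Tendsto (fun M : ℕ => ENNReal.ofReal (T * g (T / M))) atTop
      (𝓝 (ENNReal.ofReal (4 * T))) := by
    rw [mul_comm 4 T]
    exact ENNReal.tendsto_ofReal ((hgt.comp htM).const_mul T)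
  refine tendsto_of_tendsto_of_tendsto_of_le_of_le' hlow tendsto_const_nhds ?_ ?_
  · filter_upwards [eventually_gt_atTop 0] with M hM
    have hM' : (0 : ℝ) < M := by exact_mod_cast hM
    have ht : 0 < T / M := div_pos hT hM'
    have h := le_pauliMix_qfi (hσd _ ht.le) hS hψ ht.le θ
    rw [measureResetQFI, hflow]
    refine le_trans (le_of_eq ?_) (mul_le_mul_right h _)
    rw [← ENNReal.ofReal_natCast, ← ENNReal.ofReal_mul hM'.le]
    congr 1
    generalize hteq : T / M = t at *
    have hTt : T = M * t := by rw [← hteq]; field_simp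
    have hdiv : (1 - flipProb t (θ ^ 2)) * (a t / t) + flipProb t (θ ^ 2) / t * b t =
        ((1 - flipProb t (θ ^ 2)) * a t + flipProb t (θ ^ 2) * b t) / t := by ring
    simp only [hg]
    rw [hdiv, hTt, div_div_eq_mul_div]
    ring
  · filter_upwards [eventually_gt_atTop 0] with M hM
    have hM' : (0 : ℝ) < M := by exact_mod_cast hM
    have ht : 0 < T / M := div_pos hT hM'
    rw [measureResetQFI, hflow]
    refine (mul_le_mul_right (pauliMix_qfi_le (hσd _ ht.le) hS ht hθ) _).trans (le_of_eq ?_)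
    rw [← ENNReal.ofReal_natCast, ← ENNReal.ofReal_mul hM'.le]
    congr 1
    field_simp

/-! ### The noiseless case -/

/-- The identity channel. -/
def identityChannel (ι : Type) [Fintype ι] [DecidableEq ι] : Channel ι where
  rank := 1
  kraus := fun _ => 1
  sum_eq_one := by simp

theorem identityChannel_apply (ρ : Matrix ι ι ℂ) : (identityChannel ι).apply ρ = ρ := by
  rw [Channel.apply]
  exact (Fin.sum_univ_one _).trans (by simp [identityChannel])

/-- The strategy that prepares a pure state, with a trivial ancilla and no control. -/
def pureStrategy (u : ι × Fin 1 → ℂ) (hu : star u ⬝ᵥ u = 1) : SequentialStrategy ι 1 where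
  init := pureState u
  init_posSemidef := (isDensity_pureState hu).1
  init_trace := (isDensity_pureState hu).2
  control := fun _ => identityChannel _

/-- A single period of length `T`, with a one-dimensional ancilla and identity control, is already
optimal as `θ → 0`. -/
theorem le_optimalQFI (hS : IsHermitianInvolution S) (hψ : star ψ ⬝ᵥ ψ = 1)
    (h0 : star (S *ᵥ ψ) ⬝ᵥ ψ = 0) (L : Fin 0 → Matrix ι ι ℂ) (γ : Fin 0 → ℝ) {T : ℝ} (hT : 0 < T)
    (θ : ℝ) : ENNReal.ofReal ((2 * T * θ * Real.exp (-2 * T * θ ^ 2)) ^ 2 / flipProb T (θ ^ 2)) ≤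
      optimalQFI S L γ T θ := by
  set u : ι × Fin 1 → ℂ := fun x => ψ x.1 with hu
  have hS' := isHermitianInvolution_kronecker_one hS 1
  have hSu : (S ⊗ₖ (1 : Matrix (Fin 1) (Fin 1) ℂ)) *ᵥ u = fun x => (S *ᵥ ψ) x.1 := by
    ext ⟨x, i⟩
    simp [Matrix.mulVec, dotProduct, Fintype.sum_prod_type, hu, Fin.fin_one_eq_zero i]
  have hdot : ∀ φ χ : ι → ℂ, star (fun x : ι × Fin 1 => φ x.1) ⬝ᵥ (fun x => χ x.1) = star φ ⬝ᵥ χ := by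
    intro φ χ
    simp [dotProduct, Fintype.sum_prod_type]
  have hu1 : star u ⬝ᵥ u = 1 := by rw [hu, hdot, hψ]
  have hu0 : star ((S ⊗ₖ (1 : Matrix (Fin 1) (Fin 1) ℂ)) *ᵥ u) ⬝ᵥ u = 0 := by
    rw [hSu, hu, hdot, h0]
  refine le_trans ?_ (le_iSup₂_of_le 1 le_rfl (le_iSup₂_of_le 1 (pureStrategy u hu1) le_rfl))
  have hstate : (fun θ' => (pureStrategy u hu1).state S L γ (T / (1 : ℕ)) θ' 1) = fun θ' =>
      pauliMix (S ⊗ₖ (1 : Matrix (Fin 1) (Fin 1) ℂ)) (flipProb T (θ' ^ 2)) (pureState u) := by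
    funext θ'
    simp only [SequentialStrategy.state, flow_generator_noiseless hS', Nat.cast_one, div_one]
    exact identityChannel_apply _
  rw [hstate]
  have h := le_pauliMix_qfi (isDensity_pureState hu1) hS' hu1 hT.le θ
  rw [overlap_pureState, overlap_pureState, hu0, hu1] at h
  simpa using h

theorem isNoiselessQFI_of_orthogonal (hS : IsHermitianInvolution S) (hψ : star ψ ⬝ᵥ ψ = 1)
    (h0 : star (S *ᵥ ψ) ⬝ᵥ ψ = 0) {T : ℝ} (hT : 0 < T) :
    IsNoiselessQFI S T (ENNReal.ofReal (4 * T)) := by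
  have hsq : Tendsto (fun θ : ℝ => θ ^ 2) (𝓝[>] 0) (𝓝[>] 0) := by
    refine tendsto_nhdsWithin_iff.2 ⟨?_, ?_⟩
    · have h : Continuous fun θ : ℝ => θ ^ 2 := by fun_prop
      convert ((h.tendsto 0).mono_left nhdsWithin_le_nhds) using 2
      simp
    · filter_upwards [self_mem_nhdsWithin] with θ hθ
      exact pow_pos (Set.mem_Ioi.1 hθ) 2
  have hlow : Tendsto (fun θ : ℝ => ENNReal.ofReal
      ((2 * T * θ * Real.exp (-2 * T * θ ^ 2)) ^ 2 / flipProb T (θ ^ 2))) (𝓝[>] 0)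
      (𝓝 (ENNReal.ofReal (4 * T))) := by
    refine ENNReal.tendsto_ofReal ?_
    have h1 := (tendsto_flipProb_div T).comp hsq
    have h2 : Tendsto (fun θ : ℝ => (2 * T * Real.exp (-2 * T * θ ^ 2)) ^ 2) (𝓝[>] 0)
        (𝓝 ((2 * T) ^ 2)) := by
      have h : Continuous fun θ : ℝ => (2 * T * Real.exp (-2 * T * θ ^ 2)) ^ 2 := by fun_prop
      convert ((h.tendsto 0).mono_left nhdsWithin_le_nhds) using 2
      simp
    have h3 := h2.div h1 hT.ne'
    have h4 : (2 * T) ^ 2 / T = 4 * T := by field_simp; norm_num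
    rw [h4] at h3
    refine h3.congr fun θ => ?_
    simp only [Pi.div_apply, Function.comp_apply]
    rw [flipProb_comm T, div_div_eq_mul_div]
    ring
  refine tendsto_of_tendsto_of_tendsto_of_le_of_le' hlow tendsto_const_nhds ?_ ?_
  · exact Eventually.of_forall fun θ => le_optimalQFI hS hψ h0 _ _ hT θ
  · filter_upwards [self_mem_nhdsWithin] with θ hθ
    exact optimalQFI_le hS _ _ hT hθ

end LowerBound

/-! ### Tensor products of single-qubit operators -/

section Qubits

/-- The tensor product of single-qubit operators. -/
def tensorOp {n : ℕ} (A : Fin n → Matrix (Fin 2) (Fin 2) ℂ) : Matrix (Qubits n) (Qubits n) ℂ :=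
  Matrix.of fun x y => ∏ j, A j (x j) (y j)

theorem tensorOp_mul {n : ℕ} (A B : Fin n → Matrix (Fin 2) (Fin 2) ℂ) :
    tensorOp A * tensorOp B = tensorOp fun j => A j * B j := by
  ext x z
  simp only [tensorOp, Matrix.mul_apply, Matrix.of_apply, Finset.prod_univ_sum,
    Fintype.piFinset_univ, Finset.prod_mul_distrib]

theorem tensorOp_mulVec {n : ℕ} (A : Fin n → Matrix (Fin 2) (Fin 2) ℂ) (φ : Fin n → Fin 2 → ℂ) :
    tensorOp A *ᵥ productState φ = productState fun j => A j *ᵥ φ j := by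
  ext x
  simp only [tensorOp, productState, Matrix.mulVec, dotProduct, Matrix.of_apply,
    Finset.prod_univ_sum, Fintype.piFinset_univ, Finset.prod_mul_distrib]

theorem star_productState_dotProduct {n : ℕ} (φ χ : Fin n → Fin 2 → ℂ) :
    star (productState φ) ⬝ᵥ productState χ = ∏ j, star (φ j) ⬝ᵥ χ j := by
  simp only [productState, dotProduct, Pi.star_apply, star_prod, Finset.prod_univ_sum,
    Fintype.piFinset_univ, Finset.prod_mul_distrib]

theorem tensorOp_conjTranspose {n : ℕ} (A : Fin n → Matrix (Fin 2) (Fin 2) ℂ) :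
    (tensorOp A)ᴴ = tensorOp fun j => (A j)ᴴ := by
  ext x y
  simp [tensorOp, star_prod]

theorem tensorOp_one {n : ℕ} :
    tensorOp (fun _ : Fin n => (1 : Matrix (Fin 2) (Fin 2) ℂ)) = 1 := by
  ext x y
  simp only [tensorOp, Matrix.of_apply, Matrix.one_apply]
  rw [Finset.prod_ite_zero]
  simp [funext_iff]

theorem tensorOp_smul {n : ℕ} (c : Fin n → ℂ) (A : Fin n → Matrix (Fin 2) (Fin 2) ℂ) :
    (tensorOp fun j => c j • A j) = (∏ j, c j) • tensorOp A := by
  ext x y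
  simp [tensorOp, Finset.prod_mul_distrib]

theorem Pauli.isHermitianInvolution_mat (a : Pauli) : IsHermitianInvolution a.mat := by
  constructor <;> cases a <;> ext i j <;> fin_cases i <;> fin_cases j <;>
    simp [Pauli.mat]

theorem Pauli.mat_mul_mat (a b : Pauli) :
    ∃ c : ℂ, c * c = 1 ∧ a.mat * b.mat = c • (b.mat * a.mat) := by
  by_cases h : a = b ∨ a = Pauli.I ∨ b = Pauli.I
  · refine ⟨1, by norm_num, ?_⟩
    cases a <;> cases b <;> simp_all [Pauli.mat]
  · refine ⟨-1, by norm_num, ?_⟩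
    cases a <;> cases b <;> simp_all [Pauli.mat]

theorem PauliString.isHermitianInvolution_op {n : ℕ} (s : PauliString n) :
    IsHermitianInvolution s.op := by
  change IsHermitianInvolution (tensorOp fun j => (s j).mat)
  refine ⟨?_, ?_⟩
  · rw [tensorOp_conjTranspose]
    simp only [(Pauli.isHermitianInvolution_mat _).1]
  · rw [tensorOp_mul]
    simp only [(Pauli.isHermitianInvolution_mat _).2]
    exact tensorOp_one

theorem PauliString.op_mul_op {n : ℕ} (s p : PauliString n) :
    ∃ c : ℂ, c * c = 1 ∧ s.op * p.op = c • (p.op * s.op) := by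
  choose c hc h using fun j => Pauli.mat_mul_mat (s j) (p j)
  refine ⟨∏ j, c j, ?_, ?_⟩
  · rw [← Finset.prod_mul_distrib]
    simp [hc]
  · change tensorOp (fun j => (s j).mat) * tensorOp (fun j => (p j).mat) =
      (∏ j, c j) • (tensorOp (fun j => (p j).mat) * tensorOp fun j => (s j).mat)
    rw [tensorOp_mul, tensorOp_mul, ← tensorOp_smul]
    simp only [h]

/-- A multiple by a phase of the Hadamard gate. -/
noncomputable def hadamard : Matrix (Fin 2) (Fin 2) ℂ := (⟨1 / 2, 1 / 2⟩ : ℂ) • !![1, 1; 1, -1]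

/-- The prefactor `(1 + i) / 2` has modulus `1 / √2`, so no square root is needed. -/
theorem hadamard_mem : hadamard ∈ Matrix.unitaryGroup (Fin 2) ℂ := by
  rw [Matrix.mem_unitaryGroup_iff]
  ext i j
  fin_cases i <;> fin_cases j <;>
    simp [hadamard, Matrix.mul_apply, Matrix.star_apply, Complex.ext_iff] <;> norm_num

/-- A single-qubit unitary that maps `↑` to a state that the given Pauli operator maps to an
orthogonal state. -/
noncomputable def Pauli.probe : Pauli → Matrix.unitaryGroup (Fin 2) ℂ
  | .Z => ⟨hadamard, hadamard_mem⟩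
  | _ => 1

theorem unitary_ketUp_dotProduct (U : Matrix.unitaryGroup (Fin 2) ℂ) :
    star ((U : Matrix (Fin 2) (Fin 2) ℂ) *ᵥ ketUp) ⬝ᵥ ((U : Matrix (Fin 2) (Fin 2) ℂ) *ᵥ ketUp)
      = 1 := by
  have h : (U : Matrix (Fin 2) (Fin 2) ℂ)ᴴ * U = 1 := Matrix.mem_unitaryGroup_iff'.1 U.2
  rw [Matrix.star_mulVec, Matrix.dotProduct_mulVec, Matrix.vecMul_vecMul, h, Matrix.vecMul_one]
  simp [ketUp, dotProduct]

/-- `X` and `Y` send `↑` to a multiple of `↓`; `Z` exchanges the two Hadamard states. -/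
theorem Pauli.probe_orthogonal {a : Pauli} (ha : a ≠ Pauli.I) :
    star (a.mat *ᵥ ((a.probe : Matrix (Fin 2) (Fin 2) ℂ) *ᵥ ketUp)) ⬝ᵥ
      ((a.probe : Matrix (Fin 2) (Fin 2) ℂ) *ᵥ ketUp) = 0 := by
  cases a
  · exact absurd rfl ha
  all_goals
    simp [Pauli.mat, Pauli.probe, hadamard, ketUp, dotProduct, Fin.sum_univ_two]

/-- The product probe state for a Pauli signal. -/
noncomputable def PauliString.probeState {n : ℕ} (s : PauliString n) : Qubits n → ℂ :=
  productState fun j => ((s j).probe : Matrix (Fin 2) (Fin 2) ℂ) *ᵥ ketUp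

theorem PauliString.probeState_norm {n : ℕ} (s : PauliString n) :
    star s.probeState ⬝ᵥ s.probeState = 1 := by
  rw [PauliString.probeState, star_productState_dotProduct]
  exact Finset.prod_eq_one fun j _ => unitary_ketUp_dotProduct _

theorem PauliString.probeState_orthogonal {n : ℕ} {s p : PauliString n}
    (h : p.weight < s.weight) : star (s.op *ᵥ s.probeState) ⬝ᵥ (p.op *ᵥ s.probeState) = 0 := by
  -- Supports need not be nested: a strict inequality of cardinalities yields a qubit in the support
  -- of `s` outside that of `p`.
  obtain ⟨j, hj, hj'⟩ := Finset.exists_mem_notMem_of_card_lt_card h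
  have hs : s j ≠ Pauli.I := (Finset.mem_filter.1 hj).2
  have hp : p j = Pauli.I := by
    by_contra hne
    exact hj' (Finset.mem_filter.2 ⟨Finset.mem_univ j, hne⟩)
  have hI : Pauli.I.mat = 1 := by
    ext i k
    fin_cases i <;> fin_cases k <;> simp [Pauli.mat]
  change star (tensorOp (fun j => (s j).mat) *ᵥ _) ⬝ᵥ (tensorOp (fun j => (p j).mat) *ᵥ _) = 0
  rw [PauliString.probeState, tensorOp_mulVec, tensorOp_mulVec, star_productState_dotProduct]
  refine Finset.prod_eq_zero (Finset.mem_univ j) ?_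
  rw [hp, hI, Matrix.one_mulVec]
  exact Pauli.probe_orthogonal hs

theorem PauliString.probeState_orthogonal_self {n : ℕ} {s : PauliString n} (hs : 0 < s.weight) :
    star (s.op *ᵥ s.probeState) ⬝ᵥ s.probeState = 0 := by
  obtain ⟨j, hj⟩ := Finset.card_pos.1 hs
  change star (tensorOp (fun j => (s j).mat) *ᵥ _) ⬝ᵥ _ = 0
  rw [PauliString.probeState, tensorOp_mulVec, star_productState_dotProduct]
  exact Finset.prod_eq_zero (Finset.mem_univ j)
    (Pauli.probe_orthogonal (Finset.mem_filter.1 hj).2)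

end Qubits

end LindbladEstimation

open LindbladEstimation
theorem mainTheorem6 (n : ℕ) (s : PauliString n) (hs : 0 < s.weight) :
    (∀ T : ℝ, 0 < T → IsNoiselessQFI s.op T (ENNReal.ofReal (4 * T))) ∧
    ∃ U : Fin n → Matrix.unitaryGroup (Fin 2) ℂ,
      (∀ j, s j = Pauli.X → U j = 1) ∧
      ∀ (N : ℕ) (p : Fin N → PauliString n) (γ : Fin N → ℝ) (T : ℝ),
        (∀ k, (p k).weight < s.weight) → (∀ k, 0 < γ k) → 0 < T →
        IsMeasureResetQFI s.op (fun k => (p k).op) γ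
          (productState fun j => (U j : Matrix (Fin 2) (Fin 2) ℂ) *ᵥ ketUp) T
          (ENNReal.ofReal (4 * T)) := by
  have h0 := PauliString.probeState_orthogonal_self hs
  -- The probe for `X` is `1` by definition, so the condition on `U j` needs only `congrArg`.
  refine ⟨fun T hT => isNoiselessQFI_of_orthogonal s.isHermitianInvolution_op s.probeState_norm
    h0 hT, fun j => (s j).probe, fun j hj => congrArg Pauli.probe hj, fun N p γ T hp hγ hT => ?_⟩
  exact isMeasureResetQFI_of_orthogonal s.isHermitianInvolution_op
    (fun k => (p k).isHermitianInvolution_op) (fun k => s.op_mul_op (p k))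
    (fun j k => (p j).op_mul_op (p k)) hγ s.probeState_norm h0
    (fun k => PauliString.probeState_orthogonal (hp k)) hT
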